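/- A task $T_i$ is given by three positive integers: its workload $D_i$, its deadline $d_i$ and its parallelism bound $k_i$. A schedule of tasks $T_1,\dots,T_n$ on $C$ identical machines assigns to every task $T_i$ and every time slot $t\in\{1,2,\dots\}$ a number $y_i(t)\in\{0,\dots,k_i\}$ of machines, with $y_i(t)=0$ for $t\notin[1,d_i]$; it is feasible if $\sum_{t=1}^{d_i}y_i(t)\ge D_i$ for every $i$ and $\sum_{i=1}^n y_i(t)\le C$ for every $t$. Let $0=\tau_0<\tau_1<\dots<\tau_L$, where $\tau_1,\dots,\tau_L$ are the distinct deadlines. For $m\in\{1,\dots,L\}$ let $\lambda_m$ be the sum, over the tasks $T_j$ with $d_j>\tau_{L-m}$, of $D_j$ if $\lceil D_j/k_j\rceil\le d_j-\tau_{L-m}$ and of $k_j(d_j-\tau_{L-m})$ otherwise. Put $\lambda_0^C=0$ and $\lambda_m^C=\lambda_{m-1}^C+\min\{\lambda_m-\lambda_{m-1}^C,\ C(\tau_{L-m+1}-\tau_{L-m})\}$. The boundary condition for $C$ machines says that $\sum_{j}D_j-\lambda_{L-m}^C\le C\tau_m$ for all $m\in\{0,\dots,L\}$. There is an exact algorithm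 for machine minimization which runs in time $O(n^2)$ when the deadlines and the parallelism bounds are bounded by constants. Precisely: there is a single program for a unit-cost random access machine (with addition and proper subtraction as arithmetic) such that for all $\bar d,\bar k$ there is a constant $K$, depending only on $\bar d$ and $\bar k$, with the following property. For every $n\ge 1$ and all tasks $T_1,\dots,T_n$ with $d_i\le\bar d$, $k_i\le\bar k$ and $\lceil D_i/k_i\rceil\le d_i$ for all $i$, the program, given these tasks as input, halts after at most $K n^2$ steps and outputs 1. the minimum number $C^*$ of machines on which a feasible schedule of all $n$ tasks exists, and 2. a feasible schedule of all $n$ tasks on $C^*$ machines. Moreover, $C^*$ is the least $C$ that satisfies the boundary condition, and $C^*\le kn$, where $k=\max_i k_i$. -/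

import Mathlib

open Finset

/-! ### Tasks and schedules -/

/-- A malleable task: integral workload `D`, deadline `d` (the last time slot it may use) and
parallelism bound `k`, all positive. -/
structure MTask where
  workload : ℕ
  deadline : ℕ
  parBound : ℕ
  workload_pos : 0 < workload
  deadline_pos : 0 < deadline
  parBound_pos : 0 < parBound

/-- The minimal execution time `⌈D / k⌉` of a task. -/
def MTask.len (T : MTask) : ℕ := T.workload ⌈/⌉ T.parBound

/-- `y i t` is the number of machines that task `i` holds in time slot `t`. The schedule `y` is
feasible on `C` machines if task `i` only uses slots of `[1, d i]` and never more than `k i` machines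
in a slot, every task receives its workload by its deadline, and no slot uses more than `C`
machines. -/
structure FeasibleSchedule {n : ℕ} (T : Fin n → MTask) (C : ℕ) (y : Fin n → ℕ → ℕ) : Prop where
  window : ∀ i t, t ∉ Icc 1 (T i).deadline → y i t = 0
  parallelism : ∀ i t, y i t ≤ (T i).parBound
  allocated : ∀ i, (T i).workload ≤ ∑ t ∈ Icc 1 (T i).deadline, y i t
  capacity : ∀ t, ∑ i, y i t ≤ C

/-- The maximum deadline. -/
def maxDeadline {n : ℕ} (T : Fin n → MTask) : ℕ := univ.sup fun i => (T i).deadline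

/-- The maximum parallelism bound. -/
def maxParBound {n : ℕ} (T : Fin n → MTask) : ℕ := univ.sup fun i => (T i).parBound

/-! ### The boundary condition -/

/-- The number `L` of distinct deadlines. -/
def numDeadlines {n : ℕ} (T : Fin n → MTask) : ℕ := (univ.image fun i => (T i).deadline).card

/-- `0 = τ 0 < τ 1 < ... < τ L`, where `τ 1, ..., τ L` are the distinct deadlines. -/
noncomputable def tau {n : ℕ} (T : Fin n → MTask) (m : ℕ) : ℕ :=
  Nat.nth (fun t => t = 0 ∨ ∃ i, (T i).deadline = t) m

/-- The workload that can be processed in the slots `[τ (L - m) + 1, τ L]` when the number of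
machines is unlimited. A task with deadline at most `τ (L - m)` contributes `0`. -/
noncomputable def lam {n : ℕ} (T : Fin n → MTask) (m : ℕ) : ℕ :=
  ∑ j, if (T j).len ≤ (T j).deadline - tau T (numDeadlines T - m) then (T j).workload
    else (T j).parBound * ((T j).deadline - tau T (numDeadlines T - m))

/-- The workload that can be processed in the slots `[τ (L - m) + 1, τ L]` on `C` machines. -/
noncomputable def lamC {n : ℕ} (T : Fin n → MTask) (C : ℕ) : ℕ → ℕ
  | 0 => 0
  | m + 1 => lamC T C m + min (lam T (m + 1) - lamC T C m)
      (C * (tau T (numDeadlines T - m) - tau T (numDeadlines T - (m + 1))))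

/-- The workload that is left for the slots `[1, τ m]` after `C` machines have been optimally
utilized in `[τ m + 1, τ L]`. -/
noncomputable def mu {n : ℕ} (T : Fin n → MTask) (C m : ℕ) : ℕ :=
  ∑ j, (T j).workload - lamC T C (numDeadlines T - m)

/-- The boundary condition on `C` machines. -/
def BoundaryCondition {n : ℕ} (T : Fin n → MTask) (C : ℕ) : Prop :=
  ∀ m ≤ numDeadlines T, mu T C m ≤ C * tau T m

/-! ### Algorithms: structured programs of a random access machine

The machine has registers and arrays of natural numbers, of which a program can name only finitely
many. Its arithmetic is addition and proper subtraction; there is no multiplication, so that unit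
costs are realistic. -/

namespace RAM

/-- A machine state: registers `reg r` and array cells `arr a j`. -/
structure State where
  reg : ℕ → ℕ
  arr : ℕ → ℕ → ℕ

/-- Expressions. -/
inductive Expr where
  | const (c : ℕ)
  | reg (r : ℕ)
  | cell (a : ℕ) (index : Expr)
  | add (e f : Expr)
  | sub (e f : Expr)

/-- The value of an expression. -/
def Expr.eval (s : State) : Expr → ℕ
  | .const c => c
  | .reg r => s.reg r
  | .cell a e => s.arr a (e.eval s)
  | .add e f => e.eval s + f.eval s
  | .sub e f => e.eval s - f.eval s

/-- The number of elementary steps needed to evaluate an expression. -/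
def Expr.cost : Expr → ℕ
  | .const _ => 1
  | .reg _ => 1
  | .cell _ e => e.cost + 1
  | .add e f => e.cost + f.cost + 1
  | .sub e f => e.cost + f.cost + 1

/-- Tests. -/
inductive Test where
  | lt (e f : Expr)
  | not (b : Test)
  | and (b c : Test)

/-- The truth value of a test. -/
def Test.eval (s : State) : Test → Bool
  | .lt e f => decide (e.eval s < f.eval s)
  | .not b => !b.eval s
  | .and b c => b.eval s && c.eval s

/-- The number of elementary steps needed to evaluate a test. -/
def Test.cost : Test → ℕ
  | .lt e f => e.cost + f.cost + 1
  | .not b => b.cost + 1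
  | .and b c => b.cost + c.cost + 1

/-- Programs. -/
inductive Program where
  | skip
  | assign (r : ℕ) (e : Expr)
  | store (a : ℕ) (index e : Expr)
  | seq (p q : Program)
  | ifThenElse (b : Test) (p q : Program)
  | whileDo (b : Test) (p : Program)

/-- Write `v` into register `r`. -/
def State.setReg (s : State) (r v : ℕ) : State :=
  { s with reg := Function.update s.reg r v }

/-- Write `v` into cell `j` of array `a`. -/
def State.setArr (s : State) (a j v : ℕ) : State :=
  { s with arr := Function.update s.arr a (Function.update (s.arr a) j v) }

/-- `Exec p s N s'`: the program `p`, started in state `s`, halts in state `s'` after exactly `N`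
elementary steps. -/
inductive Exec : Program → State → ℕ → State → Prop where
  | skip (s : State) : Exec .skip s 1 s
  | assign (r : ℕ) (e : Expr) (s : State) :
      Exec (.assign r e) s (e.cost + 1) (s.setReg r (e.eval s))
  | store (a : ℕ) (i e : Expr) (s : State) :
      Exec (.store a i e) s (i.cost + e.cost + 1) (s.setArr a (i.eval s) (e.eval s))
  | seq {p q : Program} {s s' s'' : State} {M N : ℕ} :
      Exec p s M s' → Exec q s' N s'' → Exec (.seq p q) s (M + N) s''
  | ifTrue {b : Test} {p q : Program} {s s' : State} {N : ℕ} :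
      b.eval s = true → Exec p s N s' → Exec (.ifThenElse b p q) s (b.cost + 1 + N) s'
  | ifFalse {b : Test} {p q : Program} {s s' : State} {N : ℕ} :
      b.eval s = false → Exec q s N s' → Exec (.ifThenElse b p q) s (b.cost + 1 + N) s'
  | whileFalse {b : Test} {p : Program} {s : State} :
      b.eval s = false → Exec (.whileDo b p) s (b.cost + 1) s
  | whileTrue {b : Test} {p : Program} {s s' s'' : State} {M N : ℕ} :
      b.eval s = true → Exec p s M s' → Exec (.whileDo b p) s' N s'' →
      Exec (.whileDo b p) s (b.cost + 1 + M + N) s''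

end RAM

/-- The input of an instance with `n` tasks: `n` in register `0`, and workload, deadline and
parallelism bound of task `i` in cell `i` of the arrays `0`, `1`, `2`; everything else is `0`. -/
def inputState {n : ℕ} (T : Fin n → MTask) : RAM.State where
  reg r := if r = 0 then n else 0
  arr a j := if h : j < n then
      (if a = 0 then (T ⟨j, h⟩).workload
      else if a = 1 then (T ⟨j, h⟩).deadline
      else if a = 2 then (T ⟨j, h⟩).parBound
      else 0)
    else 0

/-- The number of machines that a final state reports: register `0`. -/
def outputMachines (s : RAM.State) : ℕ := s.reg 0

/-- The schedule that a final state reports: for `t ∈ [1, d i]`, the number of machines for task `i`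
in slot `t` is in cell `(t - 1) * n + i` of array `3`. -/
def outputSchedule {n : ℕ} (T : Fin n → MTask) (s : RAM.State) (i : Fin n) (t : ℕ) : ℕ :=
  if t ∈ Icc 1 (T i).deadline then s.arr 3 ((t - 1) * n + i) else 0

/-! ### Workload that has to be processed early -/

/-! Let `E τ` be the sum of the truncated differences `D j - k j * (d j - τ)`. After slot `τ` task
`j` can receive at most `k j * (d j - τ)`, so every feasible schedule on `C` machines satisfies `E τ
≤ C * τ` for all `τ`. The proof rests on the converse: these inequalities suffice.

For the converse the slots are filled from the last one to the first, and each slot serves the tasks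
with the longest remaining execution times first. The invariant is that the remaining workloads,
with deadlines cut off at the last unfilled slot `u`, still satisfy the inequalities for `τ ≤ u`.
One slot preserves it (`excess_step`): for a threshold `s = u - τ`, either every live task has
received `k j` machines or fits into `s` slots, and then no term of the excess grows; or all `C`
machines went to tasks that still need at least `s` slots, and then the excess drops by `C` from `τ
+ 1` to `τ`. At `u = 0` nothing remains.

Hence the minimum `C` is the maximum of `⌈E τ / τ⌉` over `1 ≤ τ ≤ maxDeadline T`, which the program
finds by repeated subtraction. The total workload is at most `n * k * d`, so for bounded `d` and `k`
even linear time suffices.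

The boundary condition is the same family of inequalities at `0` and the deadlines only, because
`lam` is complementary to `E`; between consecutive deadlines `E` is convex, so nothing is lost
(`excess_le_of_between`, `boundaryCondition_iff`). The bound `k * n` comes from `excess_le_mul`. -/

/-- The workload that does not fit into the slots after `τ`, however many machines there are. -/
def excess (D d k : ℕ → ℕ) (n τ : ℕ) : ℕ := ∑ j ∈ range n, (D j - k j * (d j - τ))

theorem excess_zero {D d k : ℕ → ℕ} {n : ℕ} (h : ∀ j < n, D j ≤ k j * d j) :
    excess D d k n 0 = 0 := by
  refine sum_eq_zero fun j hj => ?_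
  exact Nat.sub_eq_zero_of_le (h j (mem_range.1 hj))

/-- Each task fits below its deadline, so what exceeds the slots after `τ` is at most `k j * τ`.
This gives the bound `k * n` on the number of machines. -/
theorem excess_le_mul {D d k : ℕ → ℕ} {n M : ℕ} (h : ∀ j < n, D j ≤ k j * d j)
    (hM : ∀ j < n, k j ≤ M) (τ : ℕ) : excess D d k n τ ≤ M * n * τ := by
  have : excess D d k n τ ≤ ∑ j ∈ range n, M * τ := by
    refine sum_le_sum fun j hj => ?_
    have h1 := h j (mem_range.1 hj)
    have h2 := hM j (mem_range.1 hj)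
    have h3 : k j * d j ≤ k j * (d j - τ) + k j * τ := by
      rw [← mul_add]; exact Nat.mul_le_mul_left _ (by omega)
    have h4 : k j * τ ≤ M * τ := Nat.mul_le_mul_right _ h2
    omega
  refine this.trans (le_of_eq ?_)
  rw [sum_const, card_range, smul_eq_mul]; ring

theorem excess_le_sum (D d k : ℕ → ℕ) (n τ : ℕ) : excess D d k n τ ≤ ∑ j ∈ range n, D j :=
  sum_le_sum fun _ _ => Nat.sub_le _ _

theorem excess_eq_sum {D d k : ℕ → ℕ} {n τ : ℕ} (h : ∀ j < n, d j ≤ τ) :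
    excess D d k n τ = ∑ j ∈ range n, D j := by
  refine sum_congr rfl fun j hj => ?_
  simp [Nat.sub_eq_zero_of_le (h j (mem_range.1 hj))]

/-- `excess` is convex between two consecutive deadlines. -/
theorem excess_le_of_between {D d k : ℕ → ℕ} {n a b τ C : ℕ} (hd : ∀ j < n, d j ≤ a ∨ b ≤ d j)
    (ha : a < τ) (hb : τ < b) (hCa : excess D d k n a ≤ C * a) (hCb : excess D d k n b ≤ C * b) :
    excess D d k n τ ≤ C * τ := by
  obtain ⟨p, rfl⟩ := Nat.exists_eq_add_of_lt ha
  obtain ⟨q, rfl⟩ := Nat.exists_eq_add_of_lt hb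
  -- Convexity with denominators cleared: `τ` lies `p + 1` above `a` and `q + 1` below `b`.
  have key : (p + 1 + (q + 1)) * excess D d k n (a + p + 1) ≤
      (q + 1) * excess D d k n a + (p + 1) * excess D d k n (a + p + 1 + q + 1) := by
    unfold excess
    rw [mul_sum, mul_sum, mul_sum, ← sum_add_distrib]
    refine sum_le_sum fun j hj => ?_
    rcases hd j (mem_range.1 hj) with h | h
    · rw [Nat.sub_eq_zero_of_le h, Nat.sub_eq_zero_of_le (show d j ≤ a + p + 1 by omega),
        Nat.sub_eq_zero_of_le (show d j ≤ a + p + 1 + q + 1 by omega)]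
      simp only [mul_zero, Nat.sub_zero]
      exact le_of_eq (by ring)
    · obtain ⟨r, hr⟩ := Nat.exists_eq_add_of_le h
      rw [show d j - a = r + (q + 1) + (p + 1) by omega,
        show d j - (a + p + 1) = r + (q + 1) by omega,
        show d j - (a + p + 1 + q + 1) = r by omega]
      rcases Nat.le_total (D j) (k j * (r + (q + 1))) with h1 | h1
      · rw [Nat.sub_eq_zero_of_le h1]; simp
      · have h2 : k j * r ≤ k j * (r + (q + 1)) := Nat.mul_le_mul_left _ (by omega)
        have e1 := Nat.sub_add_cancel h1
        have e2 := Nat.sub_add_cancel (h2.trans h1)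
        have e3 : D j ≤ (D j - k j * (r + (q + 1) + (p + 1))) + k j * (r + (q + 1) + (p + 1)) := by
          omega
        generalize D j - k j * (r + (q + 1)) = x at *
        generalize D j - k j * r = y at *
        generalize D j - k j * (r + (q + 1) + (p + 1)) = z at *
        have e4 : y = x + k j * (q + 1) := by linarith
        have e5 : x ≤ z + k j * (p + 1) := by linarith
        subst e4
        have := Nat.mul_le_mul_left (q + 1) e5
        nlinarith
  have h1 := Nat.mul_le_mul_left (q + 1) hCa
  have h2 := Nat.mul_le_mul_left (p + 1) hCb
  refine Nat.le_of_mul_le_mul_left (c := p + 1 + (q + 1)) ?_ (by omega)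
  nlinarith

/-- One slot of the greedy schedule: if the tasks with the longest remaining execution times are
served first in slot `u + 1`, the remaining workloads fit into the slots up to `u`. -/
theorem excess_step {n u C cap : ℕ} {D D' d k y : ℕ → ℕ}
    (hy : ∀ j < n, D' j + y j = D j)
    (hdead : ∀ j < n, d j ≤ u → y j = 0)
    (hcap : cap + ∑ j ∈ range n, y j = C)
    (hG : ∀ s ≤ u, (∀ j < n, u < d j → y j = k j ∨ D' j ≤ k j * s) ∨
      (cap = 0 ∧ ∀ j < n, 0 < y j → k j * s ≤ D' j))
    (hinv : ∀ τ ≤ u + 1, excess D (fun j => min (d j) (u + 1)) k n τ ≤ C * τ) :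
    ∀ τ ≤ u, excess D' (fun j => min (d j) u) k n τ ≤ C * τ := by
  intro τ hτ
  rcases hG (u - τ) (by omega) with h | ⟨h0, h⟩
  -- At the same `τ` no term grows: a live task loses one slot, worth `k j`, but has received `k j`
  -- machines, or its new term is zero.
  · refine le_trans (sum_le_sum fun j hj => ?_) (hinv τ (by omega))
    have hj := mem_range.1 hj
    have h1 := hy j hj
    by_cases hl : u < d j
    · simp only
      rw [min_eq_right (show u ≤ d j by omega), min_eq_right (show u + 1 ≤ d j by omega)]
      rcases h j hj hl with h2 | h2
      · rw [show u + 1 - τ = (u - τ) + 1 by omega, mul_add]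
        omega
      · omega
    · have h2 := hdead j hj (by omega)
      simp only
      rw [min_eq_left (show d j ≤ u by omega), min_eq_left (show d j ≤ u + 1 by omega)]
      omega
  -- Compare with `τ + 1`, which leaves the same number `u - τ` of slots: every machine handed out
  -- reduces a term by one, and all `C` were handed out.
  · have h1 := hinv (τ + 1) (by omega)
    have h2 : excess D' (fun j => min (d j) u) k n τ + ∑ j ∈ range n, y j ≤
        excess D (fun j => min (d j) (u + 1)) k n (τ + 1) := by
      unfold excess
      rw [← sum_add_distrib]
      refine sum_le_sum fun j hj => ?_
      have hj := mem_range.1 hj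
      have h3 := hy j hj
      by_cases hl : u < d j
      · simp only
        rw [min_eq_right (show u ≤ d j by omega), min_eq_right (show u + 1 ≤ d j by omega),
          show u + 1 - (τ + 1) = u - τ by omega]
        have h4 := h j hj
        omega
      · have h4 := hdead j hj (by omega)
        simp only
        rw [min_eq_left (show d j ≤ u by omega), min_eq_left (show d j ≤ u + 1 by omega)]
        have : k j * (d j - (τ + 1)) ≤ k j * (d j - τ) := Nat.mul_le_mul_left _ (by omega)
        omega
    rw [mul_add] at h1
    omega

/-- Slot `u + 1` in the course of the greedy schedule on `C` machines: the workloads `D0` have been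
reduced to `D` by giving `y j` machines to task `j`, and `cap` machines are still idle. The levels
above `l`, and at level `l` the tasks from `v` on, have been served, where level `s` serves the
tasks whose remaining workload exceeds `k * s`. -/
structure GreedySlot (D0 d k : ℕ → ℕ) (n u C l v : ℕ) (D y : ℕ → ℕ) (cap : ℕ) : Prop where
  split : ∀ j < n, D j + y j = D0 j
  le : ∀ j < n, y j ≤ k j
  dead : ∀ j < n, d j ≤ u → y j = 0
  total : cap + ∑ j ∈ range n, y j = C
  above : ∀ s, l < s → s ≤ u → (∀ j < n, u < d j → y j = k j ∨ D j ≤ k j * s) ∨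
    (cap = 0 ∧ ∀ j < n, 0 < y j → k j * s ≤ D j)
  pos : ∀ j < n, 0 < y j → k j * l ≤ D j
  current : l ≤ u → (∀ j < n, v ≤ j → u < d j → y j = k j ∨ D j ≤ k j * l) ∨ cap = 0

namespace GreedySlot

variable {D0 d k D y : ℕ → ℕ} {n u C l v cap : ℕ}

/-- The start is level `u + 1`, where the conditions on levels up to `u` are vacuous. -/
theorem init (hy : ∀ j < n, y j = 0) : GreedySlot D0 d k n u C (u + 1) 0 D0 y C where
  split j hj := by simp [hy j hj]
  le j hj := by simp [hy j hj]
  dead j hj _ := hy j hj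
  total := by rw [sum_eq_zero fun j hj => hy j (mem_range.1 hj)]; rfl
  above s hs hs' := by omega
  pos j hj h := by simp [hy j hj] at h
  current h := by omega

/-- A completed level moves from `current` to `above`; if the machines ran out, `pos` supplies the
second alternative there. At the new level no task has been served yet, hence `v = n`. -/
theorem descend (h : GreedySlot D0 d k n u C (l + 1) 0 D y cap) :
    GreedySlot D0 d k n u C l n D y cap where
  split := h.split
  le := h.le
  dead := h.dead
  total := h.total
  above s hs hs' := by
    rcases Nat.lt_or_ge (l + 1) s with h1 | h1
    · exact h.above s h1 hs'
    · obtain rfl : s = l + 1 := by omega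
      rcases h.current hs' with h2 | h2
      · exact .inl fun j hj => h2 j hj (Nat.zero_le _)
      · exact .inr ⟨h2, h.pos⟩
  pos j hj hy := (Nat.mul_le_mul_left _ (Nat.le_succ l)).trans (h.pos j hj hy)
  current _ := .inl fun j hj hj' => by omega

theorem skip (h : GreedySlot D0 d k n u C l (v + 1) D y cap) (hv : d v ≤ u) :
    GreedySlot D0 d k n u C l v D y cap where
  split := h.split
  le := h.le
  dead := h.dead
  total := h.total
  above := h.above
  pos := h.pos
  current hl := by
    rcases h.current hl with h1 | h1
    · refine .inl fun j hj hvj hd => h1 j hj ?_ hd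
      rcases hvj.eq_or_lt with rfl | h2 <;> omega
    · exact .inr h1

/-- The grant is limited by the level, by the parallelism bound and by the idle machines. -/
theorem give (h : GreedySlot D0 d k n u C l (v + 1) D y cap) (hvn : v < n) (hv : u < d v)
    {g : ℕ} (hg : g = min (min (D v - k v * l) (k v - y v)) cap) :
    GreedySlot D0 d k n u C l v (Function.update D v (D v - g)) (Function.update y v (y v + g))
      (cap - g) where
  split j hj := by
    have h1 := h.split j hj
    by_cases hjv : j = v
    · subst hjv; simp only [Function.update_self]; omega
    · simpa [Function.update_of_ne hjv] using h1
  le j hj := by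
    have h1 := h.le j hj
    by_cases hjv : j = v
    · subst hjv; simp only [Function.update_self]; omega
    · simpa [Function.update_of_ne hjv] using h1
  dead j hj hd := by
    have h1 := h.dead j hj hd
    by_cases hjv : j = v
    · subst hjv; omega
    · simpa [Function.update_of_ne hjv] using h1
  total := by
    have h1 := h.total
    rw [sum_update_of_mem (mem_range.2 hvn)]
    rw [sum_eq_add_sum_sdiff_singleton_of_mem (mem_range.2 hvn)] at h1
    omega
  above s hs hs' := by
    rcases h.above s hs hs' with h1 | ⟨h0, h1⟩
    · refine .inl fun j hj hd => ?_
      have h2 := h1 j hj hd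
      have h3 := h.le j hj
      by_cases hjv : j = v
      · subst hjv; simp only [Function.update_self]; omega
      · simpa [Function.update_of_ne hjv] using h2
    -- No machine is idle, so nothing more is granted and the second alternative persists.
    · have : g = 0 := by omega
      subst this
      refine .inr ⟨by omega, ?_⟩
      simpa using h1
  pos j hj hy := by
    have h1 := h.pos j hj
    by_cases hjv : j = v
    · subst hjv; simp only [Function.update_self] at hy ⊢; omega
    · simp only [Function.update_of_ne hjv] at hy ⊢; exact h1 hy
  current hl := by
    rcases h.current hl with h1 | h1
    · by_cases hc : cap - g = 0
      · exact .inr hc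
      -- Since machines are left, the grant was stopped by the level or by the parallelism bound.
      · refine .inl fun j hj hvj hd => ?_
        have h3 := h.le j hj
        by_cases hjv : j = v
        · subst hjv; simp only [Function.update_self]; omega
        · have h2 := h1 j hj (by omega) hd
          simpa [Function.update_of_ne hjv] using h2
    · exact .inr (by omega)

theorem excess_le (h : GreedySlot D0 d k n u C 0 0 D y cap)
    (hinv : ∀ τ ≤ u + 1, excess D0 (fun j => min (d j) (u + 1)) k n τ ≤ C * τ) :
    ∀ τ ≤ u, excess D (fun j => min (d j) u) k n τ ≤ C * τ := by
  refine excess_step h.split h.dead h.total (fun s hs => ?_) hinv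
  rcases Nat.eq_zero_or_pos s with rfl | h0
  · rcases h.current (Nat.zero_le _) with h1 | h1
    · exact .inl fun j hj => h1 j hj (Nat.zero_le _)
    · exact .inr ⟨h1, h.pos⟩
  · exact h.above s h0 hs

end GreedySlot

/-! ### Total correctness with time bounds -/

namespace RAM

/-- The program `p`, started in `s`, halts after at most `B` steps in a state that satisfies `Q`. -/
def Halts (p : Program) (s : State) (B : ℕ) (Q : State → Prop) : Prop :=
  ∃ N s', Exec p s N s' ∧ N ≤ B ∧ Q s'

theorem Halts.mono {p : Program} {s : State} {A B : ℕ} {P Q : State → Prop}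
    (h : Halts p s A P) (hAB : A ≤ B) (hPQ : ∀ s', P s' → Q s') : Halts p s B Q := by
  obtain ⟨N, s', h1, h2, h3⟩ := h
  exact ⟨N, s', h1, h2.trans hAB, hPQ _ h3⟩

theorem Halts.skip {s : State} {Q : State → Prop} (h : Q s) : Halts .skip s 1 Q :=
  ⟨_, _, .skip s, le_rfl, h⟩

theorem Halts.assign {r : ℕ} {e : Expr} {s : State} {Q : State → Prop}
    (h : Q (s.setReg r (e.eval s))) : Halts (.assign r e) s (e.cost + 1) Q :=
  ⟨_, _, .assign r e s, le_rfl, h⟩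

theorem Halts.store {a : ℕ} {i e : Expr} {s : State} {Q : State → Prop}
    (h : Q (s.setArr a (i.eval s) (e.eval s))) :
    Halts (.store a i e) s (i.cost + e.cost + 1) Q :=
  ⟨_, _, .store a i e s, le_rfl, h⟩

/-- With the halting of `q` as the postcondition of `p`, a chain of commands is verified by symbolic
execution. -/
theorem Halts.seq {p q : Program} {s : State} {A B : ℕ} {Q : State → Prop}
    (h : Halts p s A fun s' => Halts q s' B Q) : Halts (.seq p q) s (A + B) Q := by
  obtain ⟨N, s', h1, h2, M, s'', h3, h4, h5⟩ := h
  exact ⟨_, _, .seq h1 h3, add_le_add h2 h4, h5⟩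

theorem Halts.ite {b : Test} {p q : Program} {s : State} {A : ℕ} {Q : State → Prop}
    (ht : b.eval s = true → Halts p s A Q) (hf : b.eval s = false → Halts q s A Q) :
    Halts (.ifThenElse b p q) s (b.cost + 1 + A) Q := by
  cases hb : b.eval s
  · obtain ⟨N, s', h1, h2, h3⟩ := hf hb
    exact ⟨_, _, .ifFalse hb h1, by omega, h3⟩
  · obtain ⟨N, s', h1, h2, h3⟩ := ht hb
    exact ⟨_, _, .ifTrue hb h1, by omega, h3⟩

/-- Repeat `p` while register `r` is positive. -/
def Program.loop (r : ℕ) (p : Program) : Program := .whileDo (.lt (.const 0) (.reg r)) p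

/-- Repeat `p` with the values `v - 1, ..., 0` in register `r`, where `v` is its initial value. -/
def Program.countdown (r : ℕ) (p : Program) : Program :=
  .loop r (.seq (.assign r (.sub (.reg r) (.const 1))) p)

/-- A round may lower `r` by more than one, as division by repeated subtraction does; `v` only
bounds the number of rounds. Each test costs 4 steps. -/
theorem Halts.loop {r B : ℕ} {p : Program} {Q : State → Prop} (I : ℕ → State → Prop)
    (hr : ∀ v s, I v s → s.reg r = v)
    (hp : ∀ v s, I (v + 1) s → Halts p s B fun s' => ∃ w ≤ v, I w s')
    (hQ : ∀ s, I 0 s → Q s) (v : ℕ) (s : State) (h : I v s) :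
    Halts (.loop r p) s (v * (B + 4) + 4) Q := by
  induction v using Nat.strong_induction_on generalizing s with
  | _ v ih =>
    cases v with
    | zero =>
      refine ⟨_, _, .whileFalse ?_, ?_, hQ s h⟩
      · simp [Test.eval, Expr.eval, hr _ _ h]
      · simp [Test.cost, Expr.cost]
    | succ v =>
      obtain ⟨N, s', h1, h2, w, hw, h3⟩ := hp v s h
      obtain ⟨M, s'', h4, h5, h6⟩ := ih w (by omega) s' h3
      refine ⟨_, _, .whileTrue ?_ h1 h4, ?_, h6⟩
      · simp [Test.eval, Expr.eval, hr _ _ h]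
      · have : w * (B + 4) ≤ v * (B + 4) := Nat.mul_le_mul_right _ hw
        simp only [Test.cost, Expr.cost]
        rw [Nat.succ_mul]
        omega

/-- A round adds to the body 4 steps for the test and 4 for the decrement. -/
theorem Halts.countdown {r B : ℕ} {p : Program} {Q : State → Prop} (I : ℕ → State → Prop)
    (hr : ∀ v s, I v s → s.reg r = v)
    (hp : ∀ v s, I (v + 1) s → Halts p (s.setReg r v) B (I v))
    (hQ : ∀ s, I 0 s → Q s) {v : ℕ} {s : State} (h : I v s) :
    Halts (.countdown r p) s (v * (B + 8) + 4) Q := by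
  have := Halts.loop (r := r) (p := .seq (.assign r (.sub (.reg r) (.const 1))) p) (B := 4 + B)
    (Q := Q) I hr ?_ hQ v s h
  · refine this.mono (le_of_eq ?_) fun _ => id
    ring
  · intro v s h
    refine Halts.seq (Halts.assign ?_)
    have e : (Expr.sub (.reg r) (.const 1)).eval s = v := by simp [Expr.eval, hr _ _ h]
    rw [e]
    exact (hp v s h).mono le_rfl fun s' hs' => ⟨v, le_rfl, hs'⟩

/-! ### Effects of writes on the state -/

@[simp] theorem State.setReg_reg (s : State) (r v r' : ℕ) :
    (s.setReg r v).reg r' = if r' = r then v else s.reg r' := by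
  simp [State.setReg, Function.update_apply]

@[simp] theorem State.setReg_arr (s : State) (r v : ℕ) : (s.setReg r v).arr = s.arr := rfl

@[simp] theorem State.setArr_reg (s : State) (a j v : ℕ) : (s.setArr a j v).reg = s.reg := rfl

@[simp] theorem State.setArr_arr (s : State) (a j v a' : ℕ) :
    (s.setArr a j v).arr a' = if a' = a then Function.update (s.arr a) j v else s.arr a' := by
  simp [State.setArr, Function.update_apply]

theorem State.eq_of_reg_arr {s t : State} (h : s.reg = t.reg) (h' : s.arr = t.arr) : s = t := by
  cases s; cases t; simp_all

/-- Only registers from the list `l` differ. -/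
def State.SameRegs (l : List ℕ) (s s' : State) : Prop := ∀ r ∉ l, s'.reg r = s.reg r

/-! ### The program

Registers: `0` the number `n` of tasks, `1` the maximum deadline, `2` the current task, `3` the
number of machines, `4` the current slot minus one, `5` the current level, `6` and `7` scratch, `8`
the number of idle machines, `9` the offset of the current slot in array `3`, `10` a workload, `11` a
quotient. -/

/-- Decrease register `6` by the product of register `7` and the parallelism bound of the current
task. -/
def subMul : Program := .countdown 7 (.assign 6 (.sub (.reg 6) (.cell 2 (.reg 2))))

/-- Compute the maximum deadline. -/
def computeHorizon : Program :=
  .seq (.assign 2 (.reg 0)) (.countdown 2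
    -- With proper subtraction, `a + (b - a)` is the maximum.
    (.assign 1 (.add (.reg 1) (.sub (.cell 1 (.reg 2)) (.reg 1)))))

/-- Compute the workload that has to be processed up to the current slot. -/
def computeExcess : Program :=
  .seq (.assign 10 (.const 0)) (.seq (.assign 2 (.reg 0)) (.countdown 2
    (.seq (.assign 6 (.cell 0 (.reg 2)))
    (.seq (.assign 7 (.sub (.cell 1 (.reg 2)) (.add (.reg 4) (.const 1))))
    (.seq subMul
    (.assign 10 (.add (.reg 10) (.reg 6))))))))

/-- Divide this workload by the number of the current slot, rounding up. -/
def divideExcess : Program :=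
  .seq (.assign 11 (.const 0)) (.loop 10
    (.seq (.assign 10 (.sub (.reg 10) (.add (.reg 4) (.const 1))))
    (.assign 11 (.add (.reg 11) (.const 1)))))

/-- Compute the minimum number of machines. -/
def computeMachines : Program :=
  .seq (.assign 4 (.reg 1)) (.countdown 4
    (.seq computeExcess
    (.seq divideExcess
    (.seq (.assign 3 (.add (.reg 3) (.sub (.reg 11) (.reg 3))))
    -- Adding `n` once per slot yields the offset past the last row of the table without
    -- multiplication.
    (.assign 9 (.add (.reg 9) (.reg 0)))))))

/-- Serve the current task at the current level in the current slot. -/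
def serveTask : Program :=
  .ifThenElse (.lt (.reg 4) (.cell 1 (.reg 2)))
    (.seq (.assign 6 (.cell 0 (.reg 2)))
    (.seq (.assign 7 (.reg 5))
    (.seq subMul
    -- With proper subtraction, `a - (a - b)` is the minimum: the grant is cut to the unused
    -- parallelism, then to the idle machines.
    (.seq (.assign 6 (.sub (.reg 6) (.sub (.reg 6)
      (.sub (.cell 2 (.reg 2)) (.cell 3 (.add (.reg 9) (.reg 2)))))))
    (.seq (.assign 6 (.sub (.reg 6) (.sub (.reg 6) (.reg 8))))
    (.seq (.store 0 (.reg 2) (.sub (.cell 0 (.reg 2)) (.reg 6)))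
    (.seq (.store 3 (.add (.reg 9) (.reg 2))
      (.add (.cell 3 (.add (.reg 9) (.reg 2))) (.reg 6)))
    (.assign 8 (.sub (.reg 8) (.reg 6))))))))))
    .skip

/-- Serve all tasks at the current level in the current slot. -/
def serveLevel : Program := .seq (.assign 2 (.reg 0)) (.countdown 2 serveTask)

/-- Fill the current slot. -/
def fillSlot : Program :=
  .seq (.assign 9 (.sub (.reg 9) (.reg 0)))
    (.seq (.assign 8 (.reg 3))
    (.seq (.assign 5 (.add (.reg 4) (.const 1)))
    (.countdown 5 serveLevel)))

/-- Compute a schedule. -/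
def computeSchedule : Program := .seq (.assign 4 (.reg 1)) (.countdown 4 fillSlot)

/-- Machine minimization. -/
def minimizeMachines : Program :=
  .seq computeHorizon (.seq computeMachines (.seq computeSchedule (.assign 0 (.reg 3))))

/-! ### Correctness and running time of its parts -/

theorem halts_subMul (s : State) :
    Halts subMul s (s.reg 7 * 13 + 4) fun s' =>
      s' = (s.setReg 6 (s.reg 6 - s.arr 2 (s.reg 2) * s.reg 7)).setReg 7 0 := by
  refine Halts.countdown (B := 5) (fun v s' => v ≤ s.reg 7 ∧
    s' = (s.setReg 6 (s.reg 6 - s.arr 2 (s.reg 2) * (s.reg 7 - v))).setReg 7 v) ?_ ?_ ?_ ?_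
  · rintro v _ ⟨-, rfl⟩; simp
  · rintro v _ ⟨h, rfl⟩
    refine Halts.assign ⟨by omega, State.eq_of_reg_arr (funext fun r => ?_) rfl⟩
    simp only [State.setReg_reg, State.setReg_arr, Expr.eval]
    by_cases h7 : r = 7
    · simp [h7]
    · by_cases h6 : r = 6
      · simp only [h6, if_true]
        rw [show s.reg 7 - v = (s.reg 7 - (v + 1)) + 1 by omega, mul_add]
        simp; omega
      · simp [h6, h7]
  · rintro _ ⟨-, rfl⟩; rfl
  · refine ⟨le_rfl, State.eq_of_reg_arr (funext fun r => ?_) rfl⟩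
    simp only [State.setReg_reg, Nat.sub_self, mul_zero, Nat.sub_zero]
    split_ifs with h1 h2 <;> simp_all

theorem halts_computeHorizon (s : State) (h1 : s.reg 1 = 0) :
    Halts computeHorizon s (s.reg 0 * 15 + 6) fun s' =>
      s'.arr = s.arr ∧ s.SameRegs [1, 2] s' ∧ (∀ j < s.reg 0, s.arr 1 j ≤ s'.reg 1) ∧
      ∀ m, (∀ j < s.reg 0, s.arr 1 j ≤ m) → s'.reg 1 ≤ m := by
  refine Halts.mono (Halts.seq (Halts.assign (Halts.countdown (B := 7) (v := s.reg 0) (fun v s' =>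
    s'.reg 2 = v ∧ v ≤ s.reg 0 ∧ s'.arr = s.arr ∧ s.SameRegs [1, 2] s' ∧
    (∀ j < s.reg 0, v ≤ j → s.arr 1 j ≤ s'.reg 1) ∧
    ∀ m, (∀ j < s.reg 0, s.arr 1 j ≤ m) → s'.reg 1 ≤ m) ?_ ?_ ?_ ⟨?_, ?_⟩))) ?_ fun _ => id
  · exact fun v s' h => h.1
  · rintro v s' ⟨-, hv, ha, hf, hle, hm⟩
    refine Halts.assign ⟨by simp, by omega, by simpa using ha, fun r hr => ?_, ?_, ?_⟩
    · have := hf r hr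
      simp at hr
      simp [hr, this]
    · intro j hj hvj
      simp only [State.setReg_reg, State.setReg_arr, Expr.eval, ha]
      simp
      rcases hvj.eq_or_lt with rfl | h
      · omega
      · have := hle j hj h; omega
    · intro m h
      have := hm m h
      have := h v (by omega)
      simp only [State.setReg_reg, State.setReg_arr, Expr.eval, ha]
      simp
      omega
  · rintro s' ⟨-, -, ha, hf, hle, hm⟩
    exact ⟨ha, hf, fun j hj => hle j hj (Nat.zero_le _), hm⟩
  · simp [Expr.eval]
  · simp only [Expr.eval]
    refine ⟨le_rfl, rfl, fun r hr => ?_, fun j hj hj' => by omega, fun m _ => ?_⟩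
    · simp at hr; simp [hr]
    · simp [h1]
  · simp [Expr.cost, mul_comm]; omega

/-- The bound `m` on the deadlines limits the rounds of `subMul` for each task. -/
theorem halts_computeExcess (s : State) {m : ℕ} (hm : ∀ j < s.reg 0, s.arr 1 j ≤ m) :
    Halts computeExcess s (s.reg 0 * (m * 13 + 26) + 8) fun s' =>
      s'.arr = s.arr ∧ s.SameRegs [2, 6, 7, 10] s' ∧
      s'.reg 10 = excess (s.arr 0) (s.arr 1) (s.arr 2) (s.reg 0) (s.reg 4 + 1) := by
  refine Halts.mono (Halts.seq (Halts.assign (Halts.seq (Halts.assign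
    (Halts.countdown (B := m * 13 + 18) (v := s.reg 0) (fun v s' =>
    s'.reg 2 = v ∧ v ≤ s.reg 0 ∧ s'.arr = s.arr ∧ s.SameRegs [2, 6, 7, 10] s' ∧
    s'.reg 10 + excess (s.arr 0) (s.arr 1) (s.arr 2) v (s.reg 4 + 1) =
      excess (s.arr 0) (s.arr 1) (s.arr 2) (s.reg 0) (s.reg 4 + 1))
    ?_ ?_ ?_ ⟨?_, ?_⟩))))) ?_ fun _ => id
  · exact fun v s' h => h.1
  · rintro v s' ⟨-, hv, ha, hf, he⟩
    have h4 := hf 4 (by simp)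
    have hmv := hm v (by omega)
    refine Halts.mono (Halts.seq (Halts.assign (Halts.seq (Halts.assign (Halts.seq
      (B := 4) (Halts.mono (halts_subMul _) le_rfl ?_)))))) ?_ fun _ => id
    · rintro _ rfl
      refine Halts.assign ⟨by simp, by omega, by simpa using ha, fun r hr => ?_, ?_⟩
      · have := hf r hr
        simp at hr
        simp [hr, this]
      · rw [← he]
        simp [Expr.eval, ha, h4, excess, sum_range_succ]
        ring
    · simp [Expr.cost, Expr.eval, ha, h4]
      omega
  · rintro s' ⟨-, -, ha, hf, he⟩
    exact ⟨ha, hf, by simpa [excess] using he⟩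
  · simp [Expr.eval]
  · simp only [Expr.eval]
    refine ⟨by simp, rfl, fun r hr => ?_, ?_⟩
    · simp at hr; simp [hr]
    · simp
  · simp [Expr.cost, mul_comm, add_assoc]; omega

theorem halts_divideExcess (s : State) :
    Halts divideExcess s (s.reg 10 * 14 + 6) fun s' =>
      s'.arr = s.arr ∧ s.SameRegs [10, 11] s' ∧
      s.reg 10 ≤ s'.reg 11 * (s.reg 4 + 1) ∧
      ∀ C, s.reg 10 ≤ C * (s.reg 4 + 1) → s'.reg 11 ≤ C := by
  refine Halts.mono (Halts.seq (Halts.assign (Halts.loop (B := 10) (fun v s' =>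
    s'.reg 10 = v ∧ s'.arr = s.arr ∧ s.SameRegs [10, 11] s' ∧
    v = s.reg 10 - s'.reg 11 * (s.reg 4 + 1) ∧
    ∀ C, s.reg 10 ≤ C * (s.reg 4 + 1) → s'.reg 11 ≤ C)
    ?_ ?_ ?_ (s.reg 10) _ ⟨?_, ?_⟩))) ?_ fun _ => id
  · exact fun v s' h => h.1
  · rintro v s' ⟨h10, ha, hf, hv, hC⟩
    have h4 := hf 4 (by simp)
    refine Halts.mono (Halts.seq (Halts.assign (Halts.assign ⟨v - s.reg 4, by omega, ?_, ?_, ?_,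
      ?_, ?_⟩))) ?_ fun _ => id
    · simp [Expr.cost]
    · simp [Expr.eval, h10, h4]
    · simpa using ha
    · intro r hr
      have := hf r hr
      simp at hr
      simp [hr, this]
    · simp [Expr.eval]
      rw [add_mul]
      omega
    · intro C h
      simp [Expr.eval]
      -- The remainder is still positive, so the quotient so far is below every admissible `C`, and
      -- one more round keeps it at most `C`.
      have h1 : s'.reg 11 * (s.reg 4 + 1) < C * (s.reg 4 + 1) := by omega
      exact Nat.lt_of_mul_lt_mul_right h1
  · rintro s' ⟨-, ha, hf, hv, hC⟩
    exact ⟨ha, hf, by omega, hC⟩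
  · simp
  · refine ⟨rfl, fun r hr => ?_, ?_⟩
    · simp at hr; simp [hr]
    · simp [Expr.eval]
  · simp [Expr.cost]; omega

theorem halts_computeMachines (s : State) {m M : ℕ} (h3 : s.reg 3 = 0) (h9 : s.reg 9 = 0)
    (hm : ∀ j < s.reg 0, s.arr 1 j ≤ m) (hM : ∑ j ∈ range (s.reg 0), s.arr 0 j ≤ M) :
    Halts computeMachines s (s.reg 1 * (s.reg 0 * (m * 13 + 26) + M * 14 + 32) + 6) fun s' =>
      s'.arr = s.arr ∧ s'.reg 0 = s.reg 0 ∧ s'.reg 1 = s.reg 1 ∧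
      s'.reg 9 = s.reg 1 * s.reg 0 ∧
      (∀ τ, 0 < τ → τ ≤ s.reg 1 →
        excess (s.arr 0) (s.arr 1) (s.arr 2) (s.reg 0) τ ≤ s'.reg 3 * τ) ∧
      ∀ C, (∀ τ ≤ s.reg 1, excess (s.arr 0) (s.arr 1) (s.arr 2) (s.reg 0) τ ≤ C * τ) →
        s'.reg 3 ≤ C := by
  refine Halts.mono (Halts.seq (Halts.assign (Halts.countdown
    (B := s.reg 0 * (m * 13 + 26) + M * 14 + 24) (v := s.reg 1) (fun v s' =>
    s'.reg 4 = v ∧ v ≤ s.reg 1 ∧ s'.arr = s.arr ∧ s'.reg 0 = s.reg 0 ∧ s'.reg 1 = s.reg 1 ∧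
    s'.reg 9 + v * s.reg 0 = s.reg 1 * s.reg 0 ∧
    (∀ τ, v < τ → τ ≤ s.reg 1 →
      excess (s.arr 0) (s.arr 1) (s.arr 2) (s.reg 0) τ ≤ s'.reg 3 * τ) ∧
    ∀ C, (∀ τ ≤ s.reg 1, excess (s.arr 0) (s.arr 1) (s.arr 2) (s.reg 0) τ ≤ C * τ) →
      s'.reg 3 ≤ C)
    ?_ ?_ ?_ ⟨?_, ?_⟩))) ?_ fun _ => id
  · exact fun v s' h => h.1
  · rintro v s' ⟨-, hv, ha, h0, h1, h9, hle, hC⟩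
    refine Halts.mono (Halts.seq (B := M * 14 + 16) (Halts.mono (halts_computeExcess _ (m := m) ?_) le_rfl
      ?_)) ?_ fun _ => id
    · simpa [ha, h0] using hm
    · rintro s₁ ⟨ha₁, hf₁, he₁⟩
      have e0 := hf₁ 0 (by simp)
      have e1 := hf₁ 1 (by simp)
      have e3 := hf₁ 3 (by simp)
      have e4 := hf₁ 4 (by simp)
      have e9 := hf₁ 9 (by simp)
      simp [ha, h0, h1] at ha₁ e0 e1 e3 e4 e9 he₁
      -- The dividend bounds the number of rounds of the division, and the total workload bounds the
      -- dividend.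
      have hM' := (excess_le_sum (s.arr 0) (s.arr 1) (s.arr 2) (s.reg 0) (v + 1)).trans hM
      refine Halts.mono (Halts.seq (B := 10) (Halts.mono (halts_divideExcess _) le_rfl ?_)) ?_
        fun _ => id
      · rintro s₂ ⟨ha₂, hf₂, hle₂, hC₂⟩
        have f0 := hf₂ 0 (by simp)
        have f1 := hf₂ 1 (by simp)
        have f3 := hf₂ 3 (by simp)
        have f4 := hf₂ 4 (by simp)
        have f9 := hf₂ 9 (by simp)
        rw [he₁, e4] at hle₂ hC₂
        refine Halts.mono (Halts.seq (Halts.assign (Halts.assign ⟨?_, by omega, ?_, ?_, ?_,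
          ?_, ?_, ?_⟩))) ?_ fun _ => id
        · simp [Expr.cost]
        · simp [f4, e4]
        · simp [ha₂, ha₁]
        · simp [f0, e0]
        · simp [f1, e1]
        · simp [Expr.eval, f9, e9, f0, e0]
          rw [add_mul] at h9
          omega
        · intro τ hτ hτ'
          simp [Expr.eval, f3, e3]
          rcases Nat.lt_or_ge (v + 1) τ with h | h
          · exact (hle τ h hτ').trans (Nat.mul_le_mul_right _ (by omega))
          · obtain rfl : τ = v + 1 := by omega
            exact hle₂.trans (Nat.mul_le_mul_right _ (by omega))
        · intro C h
          have g1 := hC C h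
          have g2 := hC₂ C (h (v + 1) hv)
          simp [Expr.eval, f3, e3]
          omega
      · rw [he₁]; omega
    · simp [h0]; omega
  · rintro s' ⟨-, -, ha, h0, h1, h9, hle, hC⟩
    exact ⟨ha, h0, h1, by simpa using h9, hle, hC⟩
  · simp [Expr.eval]
  · simp only [Expr.eval]
    refine ⟨le_rfl, rfl, by simp, by simp, by simp [h9], fun τ h h' => by omega, ?_⟩
    simp [h3]
  · simp [Expr.cost]
    rw [show s.reg 0 * (m * 13 + 26) + M * 14 + 24 + 8 = s.reg 0 * (m * 13 + 26) + M * 14 + 32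
      by ring]
    omega

theorem halts_serveTask (s : State) {D0 : ℕ → ℕ} {u C l v m : ℕ} (hm : s.arr 1 v ≤ m)
    (hlu : l ≤ u) (h4 : s.reg 4 = u) (h5 : s.reg 5 = l) (h2 : s.reg 2 = v) (hv : v < s.reg 0)
    (h : GreedySlot D0 (s.arr 1) (s.arr 2) (s.reg 0) u C l (v + 1) (s.arr 0)
      (fun j => s.arr 3 (s.reg 9 + j)) (s.reg 8)) :
    Halts serveTask s (m * 13 + 52) fun s' =>
      s'.arr 1 = s.arr 1 ∧ s'.arr 2 = s.arr 2 ∧ s.SameRegs [6, 7, 8] s' ∧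
      (∀ i, (i < s.reg 9 ∨ s.reg 9 + s.reg 0 ≤ i) → s'.arr 3 i = s.arr 3 i) ∧
      GreedySlot D0 (s.arr 1) (s.arr 2) (s.reg 0) u C l v (s'.arr 0)
      (fun j => s'.arr 3 (s.reg 9 + j)) (s'.reg 8) := by
  refine Halts.mono (Halts.ite (A := m * 13 + 47) (fun ht => ?_) (fun ht => ?_)) ?_ fun _ => id
  · simp [Test.eval, Expr.eval, h4, h2] at ht
    refine Halts.mono (Halts.seq (Halts.assign (Halts.seq (Halts.assign (Halts.seq
      (B := 38) (Halts.mono (halts_subMul _) le_rfl ?_)))))) ?_ fun _ => id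
    · rintro _ rfl
      refine Halts.mono (Halts.seq (Halts.assign (Halts.seq (Halts.assign (Halts.seq (Halts.store
        (Halts.seq (Halts.store (Halts.assign ⟨?_, ?_, ?_, ?_, ?_⟩))))))))) ?_ fun _ => id
      · simp [Expr.cost]
      · simp
      · simp
      · intro r hr
        simp at hr
        simp [hr]
      · intro i hi
        simp [Expr.eval, h2]
        rw [Function.update_of_ne (by omega)]
      · have key := h.give hv ht rfl
        simp [Expr.eval, h2, h5]
        generalize hg : min (min (s.arr 0 v - s.arr 2 v * l) (s.arr 2 v - s.arr 3 (s.reg 9 + v)))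
          (s.reg 8) = g at key
        have hg' : ∀ a b c : ℕ, a - (a - b) - (a - (a - b) - c) = min (min a b) c := by
          intro a b c; omega
        rw [hg', hg]
        convert key using 1
        funext j
        simp [Function.update_apply]
    -- A live task has `l ≤ u < d v ≤ m`, so `subMul` makes at most `m` rounds.
    · simp [Expr.cost, Expr.eval, h5]
      omega
  · simp [Test.eval, Expr.eval, h4, h2] at ht
    exact Halts.mono (Halts.skip ⟨rfl, rfl, fun _ _ => rfl, fun _ _ => rfl, h.skip ht⟩) (by omega)
      fun _ => id
  · simp [Test.cost, Expr.cost]; omega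


theorem halts_serveLevel (s : State) {D0 : ℕ → ℕ} {u C l m : ℕ}
    (hm : ∀ j < s.reg 0, s.arr 1 j ≤ m)
    (hlu : l ≤ u) (h4 : s.reg 4 = u) (h5 : s.reg 5 = l)
    (h : GreedySlot D0 (s.arr 1) (s.arr 2) (s.reg 0) u C (l + 1) 0 (s.arr 0)
      (fun j => s.arr 3 (s.reg 9 + j)) (s.reg 8)) :
    Halts serveLevel s (s.reg 0 * (m * 13 + 60) + 6) fun s' =>
      s'.arr 1 = s.arr 1 ∧ s'.arr 2 = s.arr 2 ∧ s.SameRegs [2, 6, 7, 8] s' ∧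
      (∀ i, (i < s.reg 9 ∨ s.reg 9 + s.reg 0 ≤ i) → s'.arr 3 i = s.arr 3 i) ∧
      GreedySlot D0 (s.arr 1) (s.arr 2) (s.reg 0) u C l 0 (s'.arr 0)
      (fun j => s'.arr 3 (s.reg 9 + j)) (s'.reg 8) := by
  refine Halts.mono (Halts.seq (Halts.assign (Halts.countdown (B := m * 13 + 52) (v := s.reg 0)
    (fun v s' => s'.reg 2 = v ∧ v ≤ s.reg 0 ∧
      s'.arr 1 = s.arr 1 ∧ s'.arr 2 = s.arr 2 ∧ s.SameRegs [2, 6, 7, 8] s' ∧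
      (∀ i, (i < s.reg 9 ∨ s.reg 9 + s.reg 0 ≤ i) → s'.arr 3 i = s.arr 3 i) ∧
      GreedySlot D0 (s.arr 1) (s.arr 2) (s.reg 0) u C l v (s'.arr 0)
      (fun j => s'.arr 3 (s.reg 9 + j)) (s'.reg 8))
    ?_ ?_ ?_ ⟨?_, ?_⟩))) ?_ fun _ => id
  · exact fun v s' h => h.1
  · rintro v s' ⟨-, hv, ha₁, ha₂, hf, ho, hG⟩
    have e0 := hf 0 (by simp)
    have e4 := hf 4 (by simp)
    have e5 := hf 5 (by simp)
    have e9 := hf 9 (by simp)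
    refine Halts.mono (halts_serveTask (D0 := D0) (u := u) (C := C) (l := l) (v := v) (m := m) _
      ?_ hlu ?_ ?_ ?_ ?_ ?_) le_rfl ?_
    · simpa [ha₁] using hm v hv
    · simp [e4, h4]
    · simp [e5, h5]
    · simp
    · simp [e0]; omega
    · simpa [ha₁, ha₂, e0, e9] using hG
    · rintro s'' ⟨hb₁, hb₂, hf', ho', hG'⟩
      simp [ha₁, ha₂, e0, e9] at hb₁ hb₂ ho' hG'
      refine ⟨?_, by omega, hb₁, hb₂, fun r hr => ?_, fun i hi => ?_, hG'⟩
      · have := hf' 2 (by simp)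
        simpa using this
      · rw [← hf r hr]
        simp at hr
        rw [hf' r (by simp [hr])]
        simp [hr]
      · rw [ho' i hi, ho i hi]
  · rintro s' ⟨-, -, h⟩
    exact h
  · simp [Expr.eval]
  · refine ⟨le_rfl, rfl, rfl, fun r hr => ?_, fun _ _ => rfl, ?_⟩
    · simp at hr; simp [hr]
    · simpa using h.descend
  · simp [Expr.cost, add_assoc]; omega

/-- Register `9` points past the row on entry and to its start `b` on exit. The row must be empty
for the greedy slot to start. -/
theorem halts_fillSlot (s : State) {b u m : ℕ} (hm : ∀ j < s.reg 0, s.arr 1 j ≤ m)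
    (hu : u + 1 ≤ m) (h4 : s.reg 4 = u) (h9 : s.reg 9 = b + s.reg 0)
    (hy : ∀ j < s.reg 0, s.arr 3 (b + j) = 0) :
    Halts fillSlot s (m * (s.reg 0 * (m * 13 + 60) + 14) + 14) fun s' =>
      s'.arr 1 = s.arr 1 ∧ s'.arr 2 = s.arr 2 ∧ s.SameRegs [2, 5, 6, 7, 8, 9] s' ∧ s'.reg 9 = b ∧
      (∀ i, (i < b ∨ b + s.reg 0 ≤ i) → s'.arr 3 i = s.arr 3 i) ∧
      GreedySlot (s.arr 0) (s.arr 1) (s.arr 2) (s.reg 0) u (s.reg 3) 0 0 (s'.arr 0)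
      (fun j => s'.arr 3 (b + j)) (s'.reg 8) := by
  refine Halts.mono (Halts.seq (Halts.assign (Halts.seq (Halts.assign (Halts.seq (Halts.assign
    (Halts.countdown (B := s.reg 0 * (m * 13 + 60) + 6) (v := u + 1)
    (fun l s' => s'.reg 5 = l ∧ l ≤ u + 1 ∧
      s'.arr 1 = s.arr 1 ∧ s'.arr 2 = s.arr 2 ∧ s.SameRegs [2, 5, 6, 7, 8, 9] s' ∧ s'.reg 9 = b ∧
      (∀ i, (i < b ∨ b + s.reg 0 ≤ i) → s'.arr 3 i = s.arr 3 i) ∧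
      GreedySlot (s.arr 0) (s.arr 1) (s.arr 2) (s.reg 0) u (s.reg 3) l 0 (s'.arr 0)
      (fun j => s'.arr 3 (b + j)) (s'.reg 8))
    ?_ ?_ ?_ ⟨?_, ?_⟩))))))) ?_ fun _ => id
  · exact fun v s' h => h.1
  · rintro l s' ⟨-, hl, ha₁, ha₂, hf, e9, ho, hG⟩
    have e0 := hf 0 (by simp)
    have e4 := hf 4 (by simp)
    refine Halts.mono (halts_serveLevel (D0 := s.arr 0) (u := u) (C := s.reg 3) (l := l) (m := m) _
      ?_ ?_ ?_ ?_ ?_) ?_ ?_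
    · simpa [ha₁, e0] using hm
    · omega
    · simp [e4, h4]
    · simp
    · simpa [ha₁, ha₂, e0, e9] using hG
    · simp [e0]
    · rintro s'' ⟨hb₁, hb₂, hf', ho', hG'⟩
      simp [ha₁, ha₂, e0, e9] at hb₁ hb₂ ho' hG'
      refine ⟨?_, by omega, hb₁, hb₂, fun r hr => ?_, ?_, fun i hi => ?_, hG'⟩
      · have := hf' 5 (by simp)
        simpa using this
      · rw [← hf r hr]
        simp at hr
        rw [hf' r (by simp [hr])]
        simp [hr]
      · have := hf' 9 (by simp)
        simpa [e9] using this
      · rw [ho' i hi, ho i hi]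
  · rintro s' ⟨-, -, h⟩
    exact h
  · simp [Expr.eval, h4]
  · refine ⟨le_rfl, rfl, rfl, fun r hr => ?_, ?_, fun _ _ => rfl, ?_⟩
    · simp at hr; simp [hr]
    · simp [Expr.eval, h9]
    · simpa [Expr.eval] using GreedySlot.init hy
  · simp only [Expr.cost]
    have := Nat.mul_le_mul_right (s.reg 0 * (m * 13 + 60) + 14) hu
    rw [show s.reg 0 * (m * 13 + 60) + 6 + 8 = s.reg 0 * (m * 13 + 60) + 14 by ring]
    omega

theorem halts_computeSchedule (s : State) {m : ℕ} (hm : ∀ j < s.reg 0, s.arr 1 j ≤ m)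
    (hH : ∀ j < s.reg 0, s.arr 1 j ≤ s.reg 1) (hHm : s.reg 1 ≤ m)
    (h9 : s.reg 9 = s.reg 1 * s.reg 0) (hy : ∀ i, s.arr 3 i = 0)
    (hC : ∀ τ ≤ s.reg 1,
      excess (s.arr 0) (s.arr 1) (s.arr 2) (s.reg 0) τ ≤ s.reg 3 * τ) :
    Halts computeSchedule s (m * (m * (s.reg 0 * (m * 13 + 60) + 14) + 22) + 6) fun s' =>
      s'.reg 3 = s.reg 3 ∧
      (∀ t < s.reg 1, ∑ j ∈ range (s.reg 0), s'.arr 3 (t * s.reg 0 + j) ≤ s.reg 3) ∧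
      (∀ t < s.reg 1, ∀ j < s.reg 0, s'.arr 3 (t * s.reg 0 + j) ≤ s.arr 2 j ∧
        (s.arr 1 j ≤ t → s'.arr 3 (t * s.reg 0 + j) = 0)) ∧
      ∀ j < s.reg 0, ∑ t ∈ range (s.reg 1), s'.arr 3 (t * s.reg 0 + j) = s.arr 0 j := by
  refine Halts.mono (Halts.seq (Halts.assign (Halts.countdown
    (B := m * (s.reg 0 * (m * 13 + 60) + 14) + 14) (v := s.reg 1)
    (fun t s' => s'.reg 4 = t ∧ t ≤ s.reg 1 ∧ s'.reg 0 = s.reg 0 ∧ s'.reg 3 = s.reg 3 ∧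
      s'.reg 9 = t * s.reg 0 ∧ s'.arr 1 = s.arr 1 ∧ s'.arr 2 = s.arr 2 ∧
      (∀ i < t * s.reg 0, s'.arr 3 i = 0) ∧
      (∀ t', t ≤ t' → t' < s.reg 1 →
        ∑ j ∈ range (s.reg 0), s'.arr 3 (t' * s.reg 0 + j) ≤ s.reg 3) ∧
      (∀ t', t ≤ t' → t' < s.reg 1 → ∀ j < s.reg 0, s'.arr 3 (t' * s.reg 0 + j) ≤ s.arr 2 j ∧
        (s.arr 1 j ≤ t' → s'.arr 3 (t' * s.reg 0 + j) = 0)) ∧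
      (∀ j < s.reg 0,
        s'.arr 0 j + ∑ t' ∈ Ico t (s.reg 1), s'.arr 3 (t' * s.reg 0 + j) = s.arr 0 j) ∧
      ∀ τ ≤ t, excess (s'.arr 0) (fun j => min (s.arr 1 j) t) (s.arr 2) (s.reg 0) τ ≤
        s.reg 3 * τ)
    ?_ ?_ ?_ ⟨?_, ?_⟩))) ?_ fun _ => id
  · exact fun v s' h => h.1
  · rintro u s' ⟨-, hu, e0, e3, e9, ha₁, ha₂, hz, hcap, hpar, hsum, hex⟩
    refine Halts.mono (halts_fillSlot (b := u * s.reg 0) (u := u) (m := m) _ ?_ ?_ ?_ ?_ ?_) ?_ ?_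
    · simpa [ha₁, e0] using hm
    · omega
    · simp
    · simp [e9, e0, add_mul]
    · simp only [State.setReg_reg, State.setReg_arr]
      intro j hj
      simp [e0] at hj
      refine hz _ ?_
      rw [add_mul, one_mul]; omega
    · simp [e0]
    · rintro s'' ⟨hb₁, hb₂, hf, f9, ho, hG⟩
      simp [ha₁, ha₂, e0, e3] at hb₁ hb₂ ho hG
      have f0 := hf 0 (by simp)
      have f3 := hf 3 (by simp)
      have f4 := hf 4 (by simp)
      simp [e0, e3] at f0 f3 f4
      -- Later rows begin at or beyond the end of row `u`, so filling row `u` leaves them alone.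
      have hlater : ∀ t', u + 1 ≤ t' → ∀ j, s''.arr 3 (t' * s.reg 0 + j) =
          s'.arr 3 (t' * s.reg 0 + j) := by
        intro t' ht' j
        refine ho _ (.inr ?_)
        have := Nat.mul_le_mul_right (s.reg 0) ht'
        rw [add_mul, one_mul] at this
        omega
      refine ⟨f4, by omega, f0, f3, f9, hb₁, hb₂, fun i hi => ?_, fun t' h1 h2 => ?_,
        fun t' h1 h2 j hj => ?_, fun j hj => ?_, hG.excess_le hex⟩
      · rw [ho i (.inl hi)]
        refine hz i ?_
        rw [add_mul, one_mul]; omega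
      · rcases h1.eq_or_lt with rfl | h1
        · have := hG.total
          omega
        · simp only [hlater t' h1]
          exact hcap t' h1 h2
      · rcases h1.eq_or_lt with rfl | h1
        · exact ⟨hG.le j hj, hG.dead j hj⟩
        · simp only [hlater t' h1]
          exact hpar t' h1 h2 j hj
      · rw [sum_eq_sum_Ico_succ_bot (by omega), ← hsum j hj, ← hG.split j hj, add_assoc]
        congr 2
        refine sum_congr rfl fun t' ht' => ?_
        rw [mem_Ico] at ht'
        exact hlater t' ht'.1 j
  · rintro s' ⟨-, -, -, e3, -, -, -, -, hcap, hpar, hsum, hex⟩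
    refine ⟨e3, fun t => hcap t (Nat.zero_le _), fun t => hpar t (Nat.zero_le _), fun j hj => ?_⟩
    -- With all deadlines cut off at `0` the excess is the whole remaining workload, so nothing
    -- remains.
    have h1 := hex 0 le_rfl
    rw [excess_eq_sum (by simp), mul_zero, Nat.le_zero] at h1
    have h2 := hsum j hj
    rw [sum_eq_zero_iff.1 h1 j (mem_range.2 hj), zero_add] at h2
    rw [← h2, range_eq_Ico]
  · simp [Expr.eval]
  · refine ⟨le_rfl, rfl, rfl, h9, rfl, rfl, fun i _ => hy i, fun t h1 h2 => by omega,
      fun t h1 h2 => by omega, fun j hj => by simp, fun τ hτ => ?_⟩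
    -- Initially the cut-off lies at or above every deadline and changes nothing.
    refine le_trans (le_of_eq ?_) (hC τ hτ)
    refine sum_congr rfl fun j hj => ?_
    simp only [State.setReg_arr]
    rw [min_eq_left (hH j (mem_range.1 hj))]
  · simp only [Expr.cost]
    have := Nat.mul_le_mul_right (m * (s.reg 0 * (m * 13 + 60) + 14) + 22) hHm
    rw [show m * (s.reg 0 * (m * 13 + 60) + 14) + 14 + 8 =
      m * (s.reg 0 * (m * 13 + 60) + 14) + 22 by ring]
    omega

end RAM

/-! ### Feasibility and the boundary condition -/

section Tasks

variable {n : ℕ} (T : Fin n → MTask)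

@[simp] theorem inputState_workload (i : Fin n) :
    (inputState T).arr 0 i = (T i).workload := by
  simp [inputState]

@[simp] theorem inputState_deadline (i : Fin n) :
    (inputState T).arr 1 i = (T i).deadline := by
  simp [inputState]

@[simp] theorem inputState_parBound (i : Fin n) :
    (inputState T).arr 2 i = (T i).parBound := by
  simp [inputState]

/-- The workload that no schedule can process after slot `τ`. -/
def earlyWork (τ : ℕ) : ℕ :=
  excess ((inputState T).arr 0) ((inputState T).arr 1) ((inputState T).arr 2) n τ

theorem earlyWork_eq_sum (τ : ℕ) : earlyWork T τ =
    ∑ i, ((T i).workload - (T i).parBound * ((T i).deadline - τ)) := by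
  simp [earlyWork, excess, sum_range]

theorem MTask.len_le_iff (t : MTask) (c : ℕ) : t.len ≤ c ↔ t.workload ≤ t.parBound * c := by
  rw [MTask.len, ceilDiv_le_iff_le_smul t.parBound_pos, smul_eq_mul]

theorem workload_le_of_len_le {T : Fin n → MTask} (h : ∀ i, (T i).len ≤ (T i).deadline) :
    ∀ j < n, (inputState T).arr 0 j ≤ (inputState T).arr 2 j * (inputState T).arr 1 j := by
  intro j hj
  have := ((T ⟨j, hj⟩).len_le_iff _).1 (h ⟨j, hj⟩)
  rw [← inputState_workload T, ← inputState_deadline T, ← inputState_parBound T] at this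
  exact this

/-- Task `i` receives at most `k i` machines in each of the slots between `τ` and its deadline; the
rest of its workload competes for the `C * τ` machine slots up to `τ`. -/
theorem earlyWork_le_of_feasible {T : Fin n → MTask} {C : ℕ} {y : Fin n → ℕ → ℕ}
    (hy : FeasibleSchedule T C y) (τ : ℕ) : earlyWork T τ ≤ C * τ := by
  have h1 : earlyWork T τ ≤ ∑ i, ∑ t ∈ Icc 1 τ, y i t := by
    rw [earlyWork_eq_sum]
    refine sum_le_sum fun i _ => ?_
    have h2 := hy.allocated i
    have h3 : ∑ t ∈ Icc 1 (T i).deadline, y i t ≤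
        ∑ t ∈ Icc 1 τ, y i t + ∑ t ∈ Ioc τ (T i).deadline, y i t := by
      rw [← sum_union (disjoint_left.2 fun t h h' => by simp at h h'; omega)]
      refine sum_le_sum_of_subset fun t ht => ?_
      simp at ht ⊢
      omega
    have h4 : ∑ t ∈ Ioc τ (T i).deadline, y i t ≤
        (T i).parBound * ((T i).deadline - τ) := by
      refine (sum_le_card_nsmul _ _ _ fun t _ => hy.parallelism i t).trans (le_of_eq ?_)
      rw [Nat.card_Ioc, smul_eq_mul, mul_comm]
    omega
  rw [sum_comm] at h1
  refine h1.trans ((sum_le_card_nsmul _ _ _ fun t _ => hy.capacity t).trans (le_of_eq ?_))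
  simp [mul_comm]

theorem deadline_le_maxDeadline (i : Fin n) : (T i).deadline ≤ maxDeadline T :=
  le_sup (f := fun i => (T i).deadline) (mem_univ i)

theorem parBound_le_maxParBound (i : Fin n) : (T i).parBound ≤ maxParBound T :=
  le_sup (f := fun i => (T i).parBound) (mem_univ i)

theorem inputState_deadline_le : ∀ j < n, (inputState T).arr 1 j ≤ maxDeadline T := by
  intro j hj
  have := deadline_le_maxDeadline T ⟨j, hj⟩
  rwa [← inputState_deadline T] at this

theorem inputState_parBound_le : ∀ j < n, (inputState T).arr 2 j ≤ maxParBound T := by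
  intro j hj
  have := parBound_le_maxParBound T ⟨j, hj⟩
  rwa [← inputState_parBound T] at this

theorem maxDeadline_le {m : ℕ} (h : ∀ j < n, (inputState T).arr 1 j ≤ m) :
    maxDeadline T ≤ m :=
  Finset.sup_le fun i _ => by simpa using h i i.2

/-! ### The points `τ m` -/

theorem setOf_breakpoint_eq : {t | t = 0 ∨ ∃ i, (T i).deadline = t} =
    ↑(insert 0 (univ.image fun i => (T i).deadline)) := by
  ext t; simp

theorem finite_breakpoint : {t | t = 0 ∨ ∃ i, (T i).deadline = t}.Finite := by
  rw [setOf_breakpoint_eq]; exact finite_toSet _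

theorem card_breakpoint : (finite_breakpoint T).toFinset.card = numDeadlines T + 1 := by
  have : (finite_breakpoint T).toFinset = insert 0 (univ.image fun i => (T i).deadline) := by
    ext t; simp
  rw [this, card_insert_of_notMem, numDeadlines]
  simp only [mem_image, mem_univ, true_and, not_exists]
  exact fun i => (T i).deadline_pos.ne'

theorem tau_mem {m : ℕ} (hm : m ≤ numDeadlines T) :
    tau T m = 0 ∨ ∃ i, (T i).deadline = tau T m :=
  Nat.nth_mem_of_lt_card (finite_breakpoint T) (by rw [card_breakpoint]; omega)

theorem exists_tau_eq {x : ℕ} (hx : x = 0 ∨ ∃ i, (T i).deadline = x) :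
    ∃ m ≤ numDeadlines T, tau T m = x := by
  obtain ⟨m, hm, h⟩ := Nat.exists_lt_card_finite_nth_eq
    (p := fun t => t = 0 ∨ ∃ i, (T i).deadline = t) (finite_breakpoint T) hx
  rw [card_breakpoint] at hm
  exact ⟨m, by omega, h⟩

theorem tau_le_tau {a b : ℕ} (hab : a ≤ b) (hb : b ≤ numDeadlines T) : tau T a ≤ tau T b := by
  rcases hab.eq_or_lt with rfl | h
  · exact le_rfl
  · exact (Nat.nth_lt_nth_of_lt_card (finite_breakpoint T) h
      (by rw [card_breakpoint]; omega)).le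

theorem tau_le_maxDeadline {m : ℕ} (hm : m ≤ numDeadlines T) : tau T m ≤ maxDeadline T := by
  rcases tau_mem T hm with h | ⟨i, h⟩
  · omega
  · rw [← h]; exact deadline_le_maxDeadline T i

theorem deadline_le_tau (i : Fin n) : (T i).deadline ≤ tau T (numDeadlines T) := by
  obtain ⟨m, hm, h⟩ := exists_tau_eq T (.inr ⟨i, rfl⟩)
  rw [← h]
  exact tau_le_tau T hm le_rfl

/-! ### The boundary condition as a bound on early work -/

/-- Since `⌈D / k⌉ ≤ c` means `D ≤ k * c`, the summand of `lam` is `min D (k * c)`, which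
complements `D - k * c`. -/
theorem lam_add_earlyWork (m : ℕ) :
    lam T m + earlyWork T (tau T (numDeadlines T - m)) = ∑ i, (T i).workload := by
  rw [earlyWork_eq_sum, lam, ← sum_add_distrib]
  refine sum_congr rfl fun i _ => ?_
  have := (T i).len_le_iff ((T i).deadline - tau T (numDeadlines T - m))
  split_ifs <;> omega

theorem earlyWork_mono {a b : ℕ} (hab : a ≤ b) : earlyWork T a ≤ earlyWork T b := by
  rw [earlyWork_eq_sum, earlyWork_eq_sum]
  refine sum_le_sum fun i _ => ?_
  have : (T i).parBound * ((T i).deadline - b) ≤ (T i).parBound * ((T i).deadline - a) :=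
    Nat.mul_le_mul_left _ (by omega)
  omega

/-- As `earlyWork` is monotone, `lam` cannot decrease from `m` to `m + 1`, so the truncated
difference in `lamC` is a true one. -/
theorem lamC_le_lam (C m : ℕ) : lamC T C m ≤ lam T m := by
  induction m with
  | zero => exact Nat.zero_le _
  | succ m ih =>
    have h1 := lam_add_earlyWork T m
    have h2 := lam_add_earlyWork T (m + 1)
    have h3 : earlyWork T (tau T (numDeadlines T - (m + 1))) ≤
        earlyWork T (tau T (numDeadlines T - m)) :=
      earlyWork_mono T (tau_le_tau T (by omega) (by omega))
    rw [lamC]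
    omega

/-- If the minimum in `lamC` is the capacity of the interval, that capacity just moves from the
second summand to the first. Otherwise `lamC` reaches `lam`, and the early work that is left fits by
hypothesis. -/
theorem sum_workload_le_lamC_add {C : ℕ} (h : ∀ τ ≤ maxDeadline T, earlyWork T τ ≤ C * τ) {m : ℕ}
    (hm : m ≤ numDeadlines T) :
    ∑ i, (T i).workload ≤ lamC T C m + C * tau T (numDeadlines T - m) := by
  induction m with
  | zero =>
    have h1 := h _ (tau_le_maxDeadline T le_rfl)
    rw [earlyWork_eq_sum] at h1
    simp only [Nat.sub_eq_zero_of_le (deadline_le_tau T _), mul_zero, Nat.sub_zero] at h1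
    simpa [lamC] using h1
  | succ m ih =>
    have h1 := h _ (tau_le_maxDeadline T (m := numDeadlines T - (m + 1)) (by omega))
    have h2 := lam_add_earlyWork T (m + 1)
    have h3 := tau_le_tau T (a := numDeadlines T - (m + 1)) (b := numDeadlines T - m)
      (by omega) (by omega)
    have h4 : C * (tau T (numDeadlines T - m) - tau T (numDeadlines T - (m + 1))) +
        C * tau T (numDeadlines T - (m + 1)) = C * tau T (numDeadlines T - m) := by
      rw [← mul_add, Nat.sub_add_cancel h3]
    have h5 := ih (by omega)
    rw [lamC]
    omega

theorem boundaryCondition_iff (C : ℕ) :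
    BoundaryCondition T C ↔ ∀ τ ≤ maxDeadline T, earlyWork T τ ≤ C * τ := by
  classical
  constructor
  · intro h
    have hpt : ∀ x, (x = 0 ∨ ∃ i, (T i).deadline = x) → earlyWork T x ≤ C * x := by
      intro x hx
      obtain ⟨m, hm, rfl⟩ := exists_tau_eq T hx
      have h1 := h m hm
      have h2 := lamC_le_lam T C (numDeadlines T - m)
      have h3 := lam_add_earlyWork T (numDeadlines T - m)
      rw [Nat.sub_sub_self hm] at h3
      rw [mu] at h1
      omega
    intro τ hτ
    by_cases hx : τ = 0 ∨ ∃ i, (T i).deadline = τ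
    · exact hpt τ hx
    set p : ℕ → Prop := fun x => x = 0 ∨ ∃ i, (T i).deadline = x with hp
    -- The maximum deadline is attained; without tasks it is `0`, which forces `τ = 0`.
    have hex : ∃ b, τ ≤ b ∧ p b := by
      rcases isEmpty_or_nonempty (Fin n) with h0 | h0
      · exact absurd (by simpa [maxDeadline] using hτ) (not_or.1 hx).1
      · obtain ⟨i, -, hi⟩ := exists_mem_eq_sup univ univ_nonempty fun i => (T i).deadline
        exact ⟨_, hτ, .inr ⟨i, hi.symm⟩⟩
    have ha : p (Nat.findGreatest p τ) := Nat.findGreatest_spec (Nat.zero_le _) (.inl rfl)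
    obtain ⟨hb, hb'⟩ := Nat.find_spec hex
    -- The nearest breakpoints on both sides of `τ` leave no deadline strictly between them.
    refine excess_le_of_between (a := Nat.findGreatest p τ) (b := Nat.find hex) ?_ ?_ ?_
      (hpt _ ha) (hpt _ hb')
    · intro j hj
      have hpj : p ((inputState T).arr 1 j) := .inr ⟨⟨j, hj⟩, (inputState_deadline T ⟨j, hj⟩).symm⟩
      rcases Nat.le_total ((inputState T).arr 1 j) τ with h1 | h1
      · exact .inl (Nat.le_findGreatest h1 hpj)
      · exact .inr (Nat.find_min' hex ⟨h1, hpj⟩)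
    · exact lt_of_le_of_ne (Nat.findGreatest_le τ) fun e => hx (e ▸ ha)
    · exact lt_of_le_of_ne hb fun e => hx (e ▸ hb')
  · intro h m hm
    have h1 := sum_workload_le_lamC_add T h (m := numDeadlines T - m) (by omega)
    rw [Nat.sub_sub_self hm] at h1
    rw [mu]
    omega

/-- A table of machine numbers, row `t` for slot `t + 1`, is a feasible schedule. -/
theorem feasibleSchedule_output {T : Fin n → MTask} {s : RAM.State} {C : ℕ}
    (hcap : ∀ t < maxDeadline T, ∑ j ∈ range n, s.arr 3 (t * n + j) ≤ C)
    (hpar : ∀ t < maxDeadline T, ∀ j < n, s.arr 3 (t * n + j) ≤ (inputState T).arr 2 j ∧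
      ((inputState T).arr 1 j ≤ t → s.arr 3 (t * n + j) = 0))
    (hsum : ∀ j < n, ∑ t ∈ range (maxDeadline T), s.arr 3 (t * n + j) =
      (inputState T).arr 0 j) :
    FeasibleSchedule T C (outputSchedule T s) where
  window i t ht := by simp only [outputSchedule, if_neg ht]
  parallelism i t := by
    unfold outputSchedule
    split_ifs with ht
    · rw [mem_Icc] at ht
      have := deadline_le_maxDeadline T i
      simpa using (hpar (t - 1) (by omega) i i.2).1
    · exact Nat.zero_le _
  allocated i := by
    rw [← inputState_workload T i, ← hsum i i.2]
    have h1 : ∑ t ∈ Icc 1 (T i).deadline, outputSchedule T s i t =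
        ∑ t ∈ range (T i).deadline, s.arr 3 (t * n + i) := by
      rw [range_eq_Ico, sum_Ico_eq_sum_range]
      rw [show Icc 1 (T i).deadline = Ico 1 ((T i).deadline + 1) by ext; simp,
        sum_Ico_eq_sum_range]
      refine sum_congr rfl fun t ht => ?_
      rw [mem_range] at ht
      have : 1 + t ∈ Icc 1 (T i).deadline := by rw [mem_Icc]; omega
      simp [outputSchedule, this]
    rw [h1]
    -- The rows past the deadline of task `i` hold `0` for it.
    refine (sum_subset (range_mono (deadline_le_maxDeadline T i)) fun t ht ht' => ?_).ge
    rw [mem_range] at ht ht'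
    exact (hpar t ht i i.2).2 (by simpa using ht')
  capacity t := by
    by_cases ht : 1 ≤ t ∧ t ≤ maxDeadline T
    · refine le_trans ?_ (hcap (t - 1) (by omega))
      rw [sum_range]
      refine sum_le_sum fun i _ => ?_
      unfold outputSchedule
      split_ifs <;> omega
    · rw [sum_eq_zero]
      · exact Nat.zero_le _
      · intro i _
        have := deadline_le_maxDeadline T i
        rw [outputSchedule, if_neg]
        rw [mem_Icc]
        omega

/-- This makes the divisions linear in `n` for bounded deadlines and parallelism bounds. -/
theorem sum_workload_le {T : Fin n → MTask} (hT : ∀ i, (T i).len ≤ (T i).deadline) :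
    ∑ j ∈ range n, (inputState T).arr 0 j ≤ n * (maxParBound T * maxDeadline T) := by
  refine (sum_le_card_nsmul _ _ _ fun j hj => ?_).trans (le_of_eq (by
    rw [card_range, smul_eq_mul]))
  rw [mem_range] at hj
  exact (workload_le_of_len_le hT j hj).trans
    (Nat.mul_le_mul (inputState_parBound_le T j hj) (inputState_deadline_le T j hj))

end Tasks

/-! ### Total correctness of the whole program -/

namespace RAM

theorem halts_minimizeMachines {n : ℕ} {T : Fin n → MTask}
    (hT : ∀ i, (T i).len ≤ (T i).deadline) {d k : ℕ} (hd : maxDeadline T ≤ d)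
    (hk : maxParBound T ≤ k) :
    Halts minimizeMachines (inputState T)
      ((n * 15 + 6) + (d * (n * (d * 13 + 26) + n * (k * d) * 14 + 32) + 6) +
        (d * (d * (n * (d * 13 + 60) + 14) + 22) + 6) + 2) fun s =>
      FeasibleSchedule T (s.reg 0) (outputSchedule T s) ∧
      (∀ τ ≤ maxDeadline T, earlyWork T τ ≤ s.reg 0 * τ) ∧
      ∀ C, (∀ τ ≤ maxDeadline T, earlyWork T τ ≤ C * τ) → s.reg 0 ≤ C := by
  have i0 : (inputState T).reg 0 = n := rfl
  have hle := inputState_deadline_le T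
  have hsum := (sum_workload_le hT).trans
    (Nat.mul_le_mul_left n (Nat.mul_le_mul hk hd))
  refine Halts.mono (Halts.seq (B := (d * (n * (d * 13 + 26) + n * (k * d) * 14 + 32) + 6) +
        ((d * (d * (n * (d * 13 + 60) + 14) + 22) + 6) + 2))
      (Halts.mono (halts_computeHorizon _ rfl) le_rfl ?_)) ?_ fun _ => id
  · rintro s₁ ⟨ha₁, hf₁, hge₁, hlub₁⟩
    have e0 : s₁.reg 0 = n := hf₁ 0 (by simp)
    have e3 : s₁.reg 3 = 0 := hf₁ 3 (by simp)
    have e9 : s₁.reg 9 = 0 := hf₁ 9 (by simp)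
    have e1 : s₁.reg 1 = maxDeadline T :=
      le_antisymm (hlub₁ _ hle) (maxDeadline_le T hge₁)
    refine Halts.mono (Halts.seq (B := (d * (d * (n * (d * 13 + 60) + 14) + 22) + 6) + 2)
      (Halts.mono (halts_computeMachines s₁ (m := d) (M := n * (k * d)) e3 e9
      (by rw [e0, ha₁]; exact fun j hj => (hle j hj).trans hd) (by rw [e0, ha₁]; exact hsum))
      le_rfl ?_)) ?_ fun _ => id
    · rintro s₂ ⟨ha₂, f0, f1, f9, hle₂, hC₂⟩
      rw [e0, ha₁, e1] at hle₂ hC₂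
      rw [e1, e0] at f9
      rw [e0] at f0
      rw [e1] at f1
      rw [ha₁] at ha₂
      have hall : ∀ τ ≤ maxDeadline T, earlyWork T τ ≤ s₂.reg 3 * τ := by
        intro τ hτ
        rcases Nat.eq_zero_or_pos τ with rfl | h0
        -- The program does not examine `τ = 0`; there the excess vanishes because every task fits
        -- below its deadline.
        · exact (excess_zero (workload_le_of_len_le hT)).le.trans (Nat.zero_le _)
        · exact hle₂ τ h0 hτ
      have key := halts_computeSchedule s₂ (m := d)
        (by rw [f0, ha₂]; exact fun j hj => (hle j hj).trans hd)
        (by rw [f0, ha₂, f1]; exact hle) (by rw [f1]; exact hd) (by rw [f9, f1, f0])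
        (by rw [ha₂]; intro i; simp [inputState]) (by rw [f0, ha₂, f1]; exact hall)
      rw [f0, f1, ha₂] at key
      refine Halts.seq (B := 2) (Halts.mono key le_rfl ?_)
      rintro s₃ ⟨g3, hcap, hpar, hs⟩
      refine Halts.assign ⟨?_, ?_, ?_⟩
      · simp only [State.setReg_reg, if_true, Expr.eval, g3]
        exact feasibleSchedule_output hcap hpar hs
      · simpa [Expr.eval, g3] using hall
      · simp only [State.setReg_reg, if_true, Expr.eval, g3]
        exact hC₂
    · rw [e0, e1]
      have := Nat.mul_le_mul_right (n * (d * 13 + 26) + n * (k * d) * 14 + 32) hd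
      omega
  · rw [i0]; omega

end RAM

theorem proposition6 :
    ∃ P : RAM.Program, ∀ d k : ℕ, ∃ K : ℕ, ∀ (n : ℕ) (T : Fin n → MTask),
      0 < n → maxDeadline T ≤ d → maxParBound T ≤ k →
      (∀ i, (T i).len ≤ (T i).deadline) →
      ∃ (N : ℕ) (s : RAM.State),
        RAM.Exec P (inputState T) N s ∧
        N ≤ K * n ^ 2 ∧
        IsLeast {C : ℕ | ∃ y, FeasibleSchedule T C y} (outputMachines s) ∧
        FeasibleSchedule T (outputMachines s) (outputSchedule T s) ∧
        IsLeast {C : ℕ | BoundaryCondition T C} (outputMachines s) ∧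
        outputMachines s ≤ maxParBound T * n := by
  -- The time bound of `halts_minimizeMachines` is affine in `n` with nonnegative coefficients; `K`
  -- is its value at `n = 1`.
  refine ⟨RAM.minimizeMachines, fun d k => ⟨(15 + 6) +
    (d * ((d * 13 + 26) + (k * d) * 14 + 32) + 6) +
    (d * (d * ((d * 13 + 60) + 14) + 22) + 6) + 2, fun n T hn hd hk hT => ?_⟩⟩
  obtain ⟨N, s, hE, hN, hfeas, hall, hmin⟩ := RAM.halts_minimizeMachines hT hd hk
  refine ⟨N, s, hE, ?_, ⟨⟨_, hfeas⟩, ?_⟩, hfeas, ⟨?_, ?_⟩, ?_⟩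
  · obtain ⟨n, rfl⟩ : ∃ m, n = m + 1 := ⟨n - 1, by omega⟩
    refine hN.trans ?_
    -- Already `K * n` steps suffice, and `n ≤ n ^ 2`.
    refine le_trans ?_ (Nat.mul_le_mul_left _ (Nat.le_self_pow two_ne_zero (n + 1)))
    nlinarith [Nat.zero_le (n * d), Nat.zero_le (n * d ^ 2), Nat.zero_le n]
  · rintro C ⟨y, hy⟩
    exact hmin C fun τ _ => earlyWork_le_of_feasible hy τ
  · exact (boundaryCondition_iff T _).2 hall
  · exact fun C hC => hmin C ((boundaryCondition_iff T C).1 hC)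
  · exact hmin _ fun τ _ =>
      excess_le_mul (workload_le_of_len_le hT) (inputState_parBound_le T) τ
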